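/- Let $\mathbb X$ and $\mathbb U$ be Polish spaces with their Borel $\sigma$-algebras (state and action space), let $\mathcal T,\mathcal S$ be controlled transition kernels, i.e. $\mathcal T(\cdot|x,u)$ and $\mathcal S(\cdot|x,u)$ are probability measures on $\mathbb X$ depending measurably on $(x,u)\in\mathbb X\times\mathbb U$, and let $c,\hat c:\mathbb X\times\mathbb U\to\mathbb R$ be cost functions. Assume that $\mathbb U$ is compact, that $c,\hat c$ are nonnegative, bounded and continuous on $\mathbb X\times\mathbb U$, and that $\mathcal T,\mathcal S$ are weakly continuous: for every bounded continuous $v:\mathbb X\to\mathbb R$ the maps $(x,u)\mapsto\int v\,d\mathcal T(\cdot|x,u)$ and $(x,u)\mapsto\int v\,d\mathcal S(\cdot|x,u)$ are continuous on $\mathbb X\times\mathbb U$. Let $\beta\in(0,1)$. An admissible policy is a sequence $\gamma=(\gamma_t)_{t\ge 0}$ of measurable maps $\gamma_t$ from histories $(x_0,\dots,x_t,u_0,\dots,u_{t-1})\in\mathbb X^{t+1}\times\mathbb U^t$ to probability measures on $\mathbb U$. For a policy $\gamma$ and $x\in\mathbb X$ let $$J_\beta(c,\mathcal T,\gamma)(x)=\mathbb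 E^{\mathcal T,\gamma}\Big[\sum_{t=0}^\infty\beta^t c(X_t,U_t)\,\Big|\,X_0=x\Big],\qquad J^*_\beta(c,\mathcal T)(x)=\inf_\gamma J_\beta(c,\mathcal T,\gamma)(x),$$ where the infimum is over all admissible policies, $U_t$ is drawn from $\gamma_t$ applied to the history at time $t$, and $X_{t+1}$ is drawn from $\mathcal T(\cdot|X_t,U_t)$. Let $\gamma^*=\gamma^*_{\hat c,\mathcal S,\beta}:\mathbb X\to\mathbb U$ be any measurable map that, used as a deterministic stationary policy, is optimal for $(\mathcal S,\hat c)$: $J_\beta(\hat c,\mathcal S,\gamma^*)(x)=J^*_\beta(\hat c,\mathcal S)(x)$ for all $x\in\mathbb X$. Write $\|\cdot\|_\infty$ for the supremum norm and, for $f:\mathbb X\to\mathbb R$, $$d_f(\mathcal T,\mathcal S)=\sup_{x\in\mathbb X,\,u\in\mathbb U}\Big|\int f\,d\mathcal T(\cdot|x,u)-\int f\,d\mathcal S(\cdot|x,u)\Big|.$$ Then all of the following hold: $$\|J_\beta(c,\mathcal T,\gamma^*)-J^*_\beta(c,\mathcal T)\|_\infty\le\frac{2}{(1-\beta)^2}\|c-\hat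 c\|_\infty+\frac{2\beta}{(1-\beta)^2}\,d_{J^*_\beta(c,\mathcal T)}(\mathcal T,\mathcal S),$$ $$\|J_\beta(c,\mathcal T,\gamma^*)-J^*_\beta(c,\mathcal T)\|_\infty\le\frac{2}{1-\beta}\|c-\hat c\|_\infty+\frac{\beta}{1-\beta}\Big(d_{J^*_\beta(c,\mathcal T)}(\mathcal T,\mathcal S)+d_{J^*_\beta(\hat c,\mathcal S)}(\mathcal T,\mathcal S)\Big),$$ $$\|J_\beta(c,\mathcal T,\gamma^*)-J^*_\beta(c,\mathcal T)\|_\infty\le\frac{2}{1-\beta}\|c-\hat c\|_\infty+\frac{2\beta}{1-\beta}\,d_{J^*_\beta(\hat c,\mathcal S)}(\mathcal T,\mathcal S).$$ -/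

import Mathlib

open MeasureTheory ProbabilityTheory
open scoped ENNReal BoundedContinuousFunction

noncomputable section

namespace MDP

/-- The history space `X^(t+1) × U^t` at time `t`: the observed states `x₀, …, x_t` and the past
actions `u₀, …, u_(t-1)`. -/
abbrev History (X U : Type*) (t : ℕ) : Type _ := (Fin (t + 1) → X) × (Fin t → U)

section Policies

variable (X U : Type*) [MeasurableSpace X] [MeasurableSpace U]

/-- An admissible policy: at each time `t`, a measurable map from histories to probability measures
on the action space, that is, a Markov kernel. -/
structure Policy where
  /-- the decision rule used at time `t` -/
  rule : (t : ℕ) → Kernel (History X U t) U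
  /-- the decision rule takes values in probability measures -/
  isMarkov : ∀ t, IsMarkovKernel (rule t)

attribute [instance] Policy.isMarkov

end Policies

variable {X U : Type*} [MeasurableSpace X] [MeasurableSpace U]

/-- The deterministic stationary policy that plays `f x` whenever the current state is `x`. -/
def stationary (f : X → U) (hf : Measurable f) : Policy X U where
  rule t := Kernel.deterministic (fun h : History X U t => f (h.1 (Fin.last t))) (by fun_prop)
  isMarkov _ := inferInstance

/-- The history at time `n + 1` obtained from the state-action pairs at times `0, …, n` and the
new state at time `n + 1`. -/
def extendHistory (n : ℕ) (p : (Finset.Iic n → X × U) × X) : History X U (n + 1) :=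
  (Fin.snoc (α := fun _ => X)
      (fun i : Fin (n + 1) => (p.1 ⟨i, Finset.mem_Iic.2 (Nat.lt_succ_iff.1 i.2)⟩).1) p.2,
    fun i : Fin (n + 1) => (p.1 ⟨i, Finset.mem_Iic.2 (Nat.lt_succ_iff.1 i.2)⟩).2)

lemma measurable_extendHistory (n : ℕ) :
    Measurable (extendHistory n : (Finset.Iic n → X × U) × X → History X U (n + 1)) := by
  refine Measurable.prodMk (measurable_pi_lambda _ fun i => ?_) (by fun_prop)
  refine Fin.lastCases ?_ (fun j => ?_) i
  · simpa using measurable_snd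
  · simp only [Fin.snoc_castSucc]
    fun_prop

/-- One step of the controlled process: given the pairs `(x₀, u₀), …, (x_n, u_n)`, the new state is
drawn from `T(· | x_n, u_n)`, and then the new action is drawn from the decision rule at time
`n + 1`, applied to the history `(x₀, …, x_(n+1), u₀, …, u_n)`. -/
def step (T : Kernel (X × U) X) (γ : Policy X U) (n : ℕ) :
    Kernel (Finset.Iic n → X × U) (X × U) :=
  (T.comap (fun h : Finset.Iic n → X × U => h ⟨n, Finset.mem_Iic.2 le_rfl⟩)
      (measurable_pi_apply _)) ⊗ₖ
    ((γ.rule (n + 1)).comap (extendHistory n) (measurable_extendHistory n))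

instance (T : Kernel (X × U) X) [IsMarkovKernel T] (γ : Policy X U) (n : ℕ) :
    IsMarkovKernel (step T γ n) := by
  unfold step
  infer_instance

/-- The law of `(X₀, U₀)`: the state is `X₀ = x`, and `U₀` is drawn from the decision rule at
time `0`. -/
def initial (γ : Policy X U) (x : X) : Measure (X × U) :=
  (γ.rule 0 (fun _ => x, Fin.elim0)).map (fun u => (x, u))

/-- The law of the controlled process `(X_t, U_t)`, `t = 0, 1, 2, …`, on the path space, for the
transition kernel `T`, the policy `γ` and the initial state `X₀ = x`. -/
def pathLaw (T : Kernel (X × U) X) [IsMarkovKernel T] (γ : Policy X U) (x : X) :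
    Measure (ℕ → X × U) :=
  Kernel.trajMeasure (X := fun _ => X × U) (initial γ x) (step T γ)

/-- The value function `J_β(c, T, γ)` of the policy `γ` under the discounted cost criterion. -/
def value (β : ℝ) (c : X × U → ℝ) (T : Kernel (X × U) X) [IsMarkovKernel T] (γ : Policy X U)
    (x : X) : ℝ :=
  ∫ ω, ∑' t, β ^ t * c (ω t) ∂(pathLaw T γ x)

/-- The optimal value function `J*_β(c, T)`: the infimum over all admissible policies. -/
def optimalValue (β : ℝ) (c : X × U → ℝ) (T : Kernel (X × U) X) [IsMarkovKernel T] (x : X) : ℝ :=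
  ⨅ γ : Policy X U, value β c T γ x

/-- The measurable map `f : X → U` is a deterministic stationary policy that is optimal, from every
initial state, for the discounted cost criterion. -/
def IsOptimal (β : ℝ) (c : X × U → ℝ) (T : Kernel (X × U) X) [IsMarkovKernel T] (f : X → U)
    (hf : Measurable f) : Prop :=
  ∀ x, value β c T (stationary f hf) x = optimalValue β c T x

/-- The supremum norm, with values in `[0, ∞]`. -/
def supNorm {α : Type*} (f : α → ℝ) : ℝ≥0∞ := ⨆ a, ‖f a‖ₑ

/-- The discrepancy `d_f(T, S)` of two controlled transition kernels, with respect to the function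
`f`, uniformly over states and actions. -/
def discrepancy (f : X → ℝ) (T S : Kernel (X × U) X) : ℝ≥0∞ :=
  ⨆ p, ‖∫ y, f y ∂(T p) - ∫ y, f y ∂(S p)‖ₑ

/-- The standing assumptions on a Markov decision process: compact action space; nonnegative,
bounded, continuous cost; weakly continuous transition kernel. -/
structure Regular [TopologicalSpace X] [TopologicalSpace U] (T : Kernel (X × U) X)
    (c : X × U → ℝ) : Prop where
  compact : CompactSpace U
  nonneg : ∀ p, 0 ≤ c p
  bounded : supNorm c < ∞
  continuous_cost : Continuous c
  weakly_continuous : ∀ v : X →ᵇ ℝ, Continuous fun p => ∫ y, v y ∂(T p)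

end MDP

end

/-! For bounded measurable `v`, telescoping gives the identity `hasSum_residual`: the value of any
policy minus `v x` is the discounted sum of the expected residuals `c + β ∫ v dT - v`. Hence
nonnegative residuals make `v` a lower bound for all policies, and residuals at most `M` in size
along a stationary policy put its value within `M / (1 - β)` of `v`. By contraction the Bellman
equation has a bounded continuous solution, and the identity shows that it is the optimal value. Let
`v`, `w` be the optimal values of `(T, c)`, `(S, c')`, and let `δ` bound `|c - c'|`. Optimality of
`f` forces the residual of `w` in `(S, c')` to vanish on the graph of `f`, so in `(T, c)` it is at
most `δ + β d_w` there, which bounds the distance from the value of `f` to `w`. Adding `dist v w`,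
estimated through `d_v` or `d_w`, gives the last two bounds. Using `v` as the test function instead
costs a second factor `1 / (1 - β)` but involves only `d_v`: the first bound. -/

namespace MDP

/-! ### Marginals of the controlled process and the residual identity -/

section ControlledProcesses

variable {X U : Type*} [MeasurableSpace X] [MeasurableSpace U]

instance (γ : Policy X U) (x : X) : IsProbabilityMeasure (initial γ x) :=
  Measure.isProbabilityMeasure_map measurable_prodMk_left.aemeasurable

instance (T : Kernel (X × U) X) [IsMarkovKernel T] (γ : Policy X U) (x : X) :
    IsProbabilityMeasure (pathLaw T γ x) := by
  unfold pathLaw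
  infer_instance

variable (T : Kernel (X × U) X) [IsMarkovKernel T] (γ : Policy X U) (x : X)

lemma pathLaw_map_zero : (pathLaw T γ x).map (fun ω => ω 0) = initial γ x := by
  have h : (fun ω : ℕ → X × U => ω 0) =
      (fun y : (i : Finset.Iic 0) → X × U => y ⟨0, Finset.mem_Iic.2 le_rfl⟩) ∘
        Preorder.frestrictLe (π := fun _ => X × U) 0 := rfl
  rw [h, ← Measure.map_map (by fun_prop) (by fun_prop), pathLaw, Kernel.trajMeasure,
    Measure.map_comp _ _ (by fun_prop), Kernel.traj_map_frestrictLe, Kernel.partialTraj_self,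
    Measure.id_comp, Measure.map_map (by fun_prop) (by fun_prop)]
  exact Measure.map_id

/-- The law of the state-action pair at time `n + 1`, given the history up to time `n`. -/
lemma pathLaw_map_succ (n : ℕ) : (pathLaw T γ x).map (fun ω => ω (n + 1)) =
    step T γ n ∘ₘ (pathLaw T γ x).map (Preorder.frestrictLe (π := fun _ => X × U) n) := by
  have h := congrArg (Measure.map Prod.snd)
    (Kernel.map_frestrictLe_trajMeasure_compProd_eq_map_trajMeasure (X := fun _ => X × U)
      (μ₀ := initial γ x) (κ := step T γ) (a := n))
  rw [Measure.map_map (by fun_prop) (by fun_prop)] at h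
  refine Eq.trans h.symm ?_
  exact Measure.snd_compProd _ _

/-- The state at time `n + 1` is drawn from the transition kernel at the pair at time `n`. -/
lemma pathLaw_map_succ_fst (n : ℕ) : (pathLaw T γ x).map (fun ω => (ω (n + 1)).1) =
    T ∘ₘ (pathLaw T γ x).map (fun ω => ω n) := by
  have h : (fun ω : ℕ → X × U => (ω (n + 1)).1) = Prod.fst ∘ fun ω => ω (n + 1) := rfl
  have h' : (fun ω : ℕ → X × U => ω n) =
      (fun y : (i : Finset.Iic n) → X × U => y ⟨n, Finset.mem_Iic.2 le_rfl⟩) ∘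
        Preorder.frestrictLe (π := fun _ => X × U) n := rfl
  rw [h, ← Measure.map_map (by fun_prop) (by fun_prop), pathLaw_map_succ,
    Measure.map_comp _ _ (by fun_prop), ← Kernel.fst_eq, step, Kernel.fst_compProd, h',
    ← Measure.map_map (by fun_prop) (by fun_prop), ← Measure.deterministic_comp_eq_map
      (f := fun y : (i : Finset.Iic n) → X × U => y ⟨n, Finset.mem_Iic.2 le_rfl⟩) (by fun_prop),
    Measure.comp_assoc, Kernel.comp_deterministic_eq_comap]

lemma integral_initial_state {v : X → ℝ} (hv : Measurable v) :
    ∫ ω, v (ω 0).1 ∂pathLaw T γ x = v x := by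
  have h := integral_map (μ := pathLaw T γ x) (φ := fun ω => ω 0)
    (measurable_pi_apply 0).aemeasurable
    (f := fun p : X × U => v p.1) (hv.comp measurable_fst).aestronglyMeasurable
  rw [← h, pathLaw_map_zero, initial,
    integral_map (f := fun p : X × U => v p.1) measurable_prodMk_left.aemeasurable
      (hv.comp measurable_fst).aestronglyMeasurable]
  simp

lemma integral_next_state (n : ℕ) {v : X → ℝ} (hv : Measurable v) {K : ℝ}
    (hK : ∀ y, |v y| ≤ K) :
    ∫ ω, v (ω (n + 1)).1 ∂pathLaw T γ x = ∫ ω, ∫ y, v y ∂T (ω n) ∂pathLaw T γ x := by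
  have h := integral_map (μ := pathLaw T γ x) (φ := fun ω => (ω (n + 1)).1)
    (measurable_fst.comp (measurable_pi_apply (n + 1))).aemeasurable
    (f := v) hv.aestronglyMeasurable
  have hm : Measurable fun ω : ℕ → X × U => ω n := measurable_pi_apply n
  have : IsProbabilityMeasure ((pathLaw T γ x).map (fun ω => ω n)) :=
    Measure.isProbabilityMeasure_map hm.aemeasurable
  rw [← h, pathLaw_map_succ_fst, ← Measure.snd_compProd, Measure.snd,
    integral_map measurable_snd.aemeasurable hv.aestronglyMeasurable, Measure.integral_compProd,
    integral_map hm.aemeasurable]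
  · exact hv.stronglyMeasurable.integral_kernel.aestronglyMeasurable
  · exact .of_bound (hv.comp measurable_snd).aestronglyMeasurable K (.of_forall fun p => hK p.2)

/-- The defect of `v` in the evaluation equation `v(x) = c(x, u) + β ∫ v dT(x, u)`. -/
noncomputable def residual (β : ℝ) (c : X × U → ℝ) (T : Kernel (X × U) X) (v : X → ℝ)
    (p : X × U) : ℝ :=
  c p + β * ∫ y, v y ∂T p - v p.1

variable {T} in
lemma abs_integral_le_of_abs_le {v : X → ℝ} {K : ℝ} (hK : ∀ y, |v y| ≤ K) (p : X × U) :
    |∫ y, v y ∂T p| ≤ K := by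
  simpa using norm_integral_le_of_norm_le_const (μ := T p) (f := v) (.of_forall fun y => hK y)

/-- The difference between the value of a policy and a bounded function `v` is the expected
discounted sum of the residuals of `v`. -/
lemma hasSum_residual {β : ℝ} (hβ0 : 0 ≤ β) (hβ1 : β < 1) {c : X × U → ℝ} (hc : Measurable c)
    {C : ℝ} (hC : ∀ p, |c p| ≤ C) {v : X → ℝ} (hv : Measurable v) {K : ℝ}
    (hK : ∀ y, |v y| ≤ K) :
    HasSum (fun t : ℕ => β ^ t * ∫ ω, residual β c T v (ω t) ∂pathLaw T γ x)
      (value β c T γ x - v x) := by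
  set P := pathLaw T γ x with hP
  have hgeo := summable_geometric_of_lt_one hβ0 hβ1
  have hci : ∀ t : ℕ, Integrable (fun ω : ℕ → X × U => c (ω t)) P := fun t =>
    .of_bound (hc.comp (measurable_pi_apply t)).aestronglyMeasurable C (.of_forall fun ω => hC _)
  have hvi : ∀ t : ℕ, Integrable (fun ω : ℕ → X × U => v (ω t).1) P := fun t =>
    .of_bound (hv.comp (measurable_fst.comp (measurable_pi_apply t))).aestronglyMeasurable K
      (.of_forall fun ω => hK _)
  have hTv : Measurable fun p => ∫ y, v y ∂T p :=
    hv.stronglyMeasurable.integral_kernel.measurable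
  have hTi : ∀ t : ℕ, Integrable (fun ω : ℕ → X × U => ∫ y, v y ∂T (ω t)) P := fun t =>
    .of_bound (hTv.comp (measurable_pi_apply t)).aestronglyMeasurable K
      (.of_forall fun ω => abs_integral_le_of_abs_le hK _)
  have hEv : ∀ t : ℕ, ‖∫ ω, v (ω t).1 ∂P‖ ≤ K := fun t => by
    simpa using norm_integral_le_of_norm_le_const (μ := P) (f := fun ω => v (ω t).1)
      (.of_forall fun ω => hK _)
  -- Geometric domination allows the sum and the expectation to be exchanged.
  have hcost : HasSum (fun t : ℕ => β ^ t * ∫ ω, c (ω t) ∂P) (value β c T γ x) := by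
    have h := hasSum_integral_of_summable_integral_norm (μ := P)
      (F := fun (t : ℕ) (ω : ℕ → X × U) => β ^ t * c (ω t)) (fun t => (hci t).const_mul _) ?_
    · simp only [integral_const_mul] at h
      exact h
    · refine .of_nonneg_of_le (fun t => integral_nonneg fun ω => norm_nonneg _) (fun t => ?_)
        (hgeo.mul_right C)
      refine (integral_mono ((hci t).const_mul _).norm (integrable_const (β ^ t * C))
        fun ω => ?_).trans (by simp)
      simp only [norm_mul, norm_pow, Real.norm_eq_abs, abs_of_nonneg hβ0]
      exact mul_le_mul_of_nonneg_left (hC _) (by positivity)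
  have hstate : Summable (fun t : ℕ => β ^ t * ∫ ω, v (ω t).1 ∂P) := by
    refine .of_norm_bounded (hgeo.mul_right K) fun t => ?_
    rw [norm_mul, norm_pow, Real.norm_eq_abs, abs_of_nonneg hβ0]
    exact mul_le_mul_of_nonneg_left (hEv t) (by positivity)
  -- The series telescopes: only minus its term at time 0 survives, and `X₀ = x`.
  have htel : HasSum (fun t : ℕ => β ^ (t + 1) * (∫ ω, v (ω (t + 1)).1 ∂P)
      - β ^ t * ∫ ω, v (ω t).1 ∂P) (- v x) := by
    have h0 := integral_initial_state T γ x hv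
    have h1 := (hasSum_nat_add_iff' (f := fun t : ℕ => β ^ t * ∫ ω, v (ω t).1 ∂P) 1).2
      hstate.hasSum
    have h2 := h1.sub hstate.hasSum
    simp only [Finset.sum_range_one, pow_zero, one_mul, hP, h0] at h2
    simpa using h2
  convert hcost.add htel using 2 with t
  · have : ∫ ω, residual β c T v (ω t) ∂P =
        (∫ ω, c (ω t) ∂P) + β * (∫ ω, v (ω (t + 1)).1 ∂P) - ∫ ω, v (ω t).1 ∂P := by
      have h1 := integral_sub ((hci t).add ((hTi t).const_mul β)) (hvi t)
      simp only [Pi.add_apply] at h1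
      unfold residual
      rw [h1, integral_add (hci t) ((hTi t).const_mul β), integral_const_mul,
        integral_next_state T γ x t hv hK]
    rw [this]
    ring
  · exact sub_eq_add_neg _ _

omit [IsMarkovKernel T] in
lemma measurable_residual (β : ℝ) {c : X × U → ℝ} (hc : Measurable c) {v : X → ℝ}
    (hv : Measurable v) : Measurable (residual β c T v) :=
  (hc.add (hv.stronglyMeasurable.integral_kernel.measurable.const_mul β)).sub
    (hv.comp measurable_fst)

/-- If the residuals of `v` are nonnegative then `v` is a lower bound for every policy. -/
lemma le_value_of_residual_nonneg {β : ℝ} (hβ0 : 0 ≤ β) (hβ1 : β < 1) {c : X × U → ℝ}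
    (hc : Measurable c) {C : ℝ} (hC : ∀ p, |c p| ≤ C) {v : X → ℝ} (hv : Measurable v) {K : ℝ}
    (hK : ∀ y, |v y| ≤ K) (h : ∀ p, 0 ≤ residual β c T v p) : v x ≤ value β c T γ x :=
  sub_nonneg.1 <| (hasSum_residual T γ x hβ0 hβ1 hc hC hv hK).nonneg fun t =>
    mul_nonneg (pow_nonneg hβ0 t) (integral_nonneg fun _ => h _)

end ControlledProcesses

/-! ### Deterministic stationary policies -/

section Stationary

variable {X U : Type*} [MeasurableSpace X] [MeasurableSpace U] [MeasurableEq U]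
  (T : Kernel (X × U) X) [IsMarkovKernel T] {f : X → U} (hf : Measurable f) (x : X)

/-- Thanks to this, only residuals on the graph of `f` affect the value of the policy. At each time
the action is drawn from a Dirac mass at `f` of the current state. -/
lemma ae_action_eq (t : ℕ) :
    ∀ᵐ ω ∂pathLaw T (stationary f hf) x, (ω t).2 = f (ω t).1 := by
  have hs : MeasurableSet {p : X × U | p.2 = f p.1} :=
    measurableSet_eq_fun measurable_snd (hf.comp measurable_fst)
  suffices h : ∀ᵐ p ∂(pathLaw T (stationary f hf) x).map (fun ω => ω t), p.2 = f p.1 from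
    ae_of_ae_map (measurable_pi_apply t).aemeasurable h
  cases t with
  | zero =>
    rw [pathLaw_map_zero, initial, ae_map_iff (by fun_prop) hs]
    simp only [stationary]
    rw [Kernel.deterministic_apply, ae_dirac_iff]
    exact measurable_prodMk_left hs
  | succ n =>
    rw [pathLaw_map_succ]
    refine Measure.ae_comp_of_ae_ae hs (.of_forall fun y => ?_)
    rw [step, Kernel.ae_compProd_iff hs]
    refine .of_forall fun z => ?_
    have hz : MeasurableSet {u : U | u = f z} := measurable_prodMk_left (x := z) hs
    simp only [stationary]
    rw [Kernel.comap_apply, Kernel.deterministic_apply, ae_dirac_iff hz]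
    simp [extendHistory]

omit [MeasurableEq U] in
lemma integral_stationary_zero (g : X × U → ℝ) (hg : Measurable g) :
    ∫ ω, g (ω 0) ∂pathLaw T (stationary f hf) x = g (x, f x) := by
  have h := integral_map (μ := pathLaw T (stationary f hf) x) (φ := fun ω => ω 0)
    (measurable_pi_apply 0).aemeasurable
    (f := g) (by fun_prop)
  rw [← h, pathLaw_map_zero, initial, integral_map (by fun_prop) (by fun_prop)]
  simp only [stationary]
  rw [Kernel.deterministic_apply, integral_dirac' (fun u => g (x, u)) _ (hg.comp measurable_prodMk_left).stronglyMeasurable]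

variable {T x} in
/-- Bounds on the residuals of `v` along `f` bound the distance from `v` to the value of the
stationary policy `f`. -/
lemma abs_value_stationary_sub_le {β : ℝ} (hβ0 : 0 ≤ β) (hβ1 : β < 1) {c : X × U → ℝ}
    (hc : Measurable c) {C : ℝ} (hC : ∀ p, |c p| ≤ C) {v : X → ℝ} (hv : Measurable v) {K : ℝ}
    (hK : ∀ y, |v y| ≤ K) {M : ℝ} (hM : ∀ y, |residual β c T v (y, f y)| ≤ M) :
    |value β c T (stationary f hf) x - v x| ≤ M / (1 - β) := by
  have h := hasSum_residual T (stationary f hf) x hβ0 hβ1 hc hC hv hK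
  have hg := (hasSum_geometric_of_lt_one hβ0 hβ1).mul_right M
  rw [← h.tsum_eq, ← Real.norm_eq_abs, div_eq_inv_mul]
  refine tsum_of_norm_bounded hg fun t => ?_
  rw [norm_mul, norm_pow, Real.norm_eq_abs, abs_of_nonneg hβ0]
  refine mul_le_mul_of_nonneg_left ?_ (by positivity)
  have := norm_integral_le_of_norm_le_const (μ := pathLaw T (stationary f hf) x)
    (f := fun ω => residual β c T v (ω t)) (C := M) ?_
  · simpa using this
  · filter_upwards [ae_action_eq T hf x t] with ω hω
    have := hM (ω t).1
    rwa [← hω] at this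

omit [MeasurableEq U] in
variable {T x} in
/-- If the residuals of `v` are nonnegative and `v` is the value of the stationary policy `f` at
`x`, then `f` attains the evaluation equation at `x`. -/
lemma residual_eq_zero_of_value_eq {β : ℝ} (hβ0 : 0 ≤ β) (hβ1 : β < 1) {c : X × U → ℝ}
    (hc : Measurable c) {C : ℝ} (hC : ∀ p, |c p| ≤ C) {v : X → ℝ} (hv : Measurable v) {K : ℝ}
    (hK : ∀ y, |v y| ≤ K) (hr : ∀ p, 0 ≤ residual β c T v p)
    (h : value β c T (stationary f hf) x = v x) : residual β c T v (x, f x) = 0 := by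
  have hs := hasSum_residual T (stationary f hf) x hβ0 hβ1 hc hC hv hK
  -- Nonnegative terms with sum zero all vanish. The term at time 0 is the residual at the single
  -- point `(x, f x)`, so no null set is lost.
  rw [h, sub_self, hasSum_zero_iff_of_nonneg fun t =>
    mul_nonneg (pow_nonneg hβ0 t) (integral_nonneg fun _ => hr _)] at hs
  have h0 := congrFun hs 0
  rwa [pow_zero, one_mul, integral_stationary_zero T hf x _ (measurable_residual T β hc hv)] at h0

end Stationary

lemma abs_le_toReal_supNorm {α : Type*} {g : α → ℝ} (h : supNorm g < ∞) (a : α) :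
    |g a| ≤ (supNorm g).toReal := by
  have := ENNReal.toReal_mono h.ne (le_iSup (fun a => ‖g a‖ₑ) a)
  simpa using this

lemma supNorm_le_ofReal {α : Type*} {g : α → ℝ} {M : ℝ} (h : ∀ a, |g a| ≤ M) :
    supNorm g ≤ ENNReal.ofReal M := by
  refine iSup_le fun a => ?_
  rw [Real.enorm_eq_ofReal_abs]
  exact ENNReal.ofReal_le_ofReal (h a)

lemma abs_ciInf_sub_ciInf_le {ι : Type*} [Nonempty ι] {a b : ι → ℝ} (ha : BddBelow (Set.range a))
    (hb : BddBelow (Set.range b)) {M : ℝ} (h : ∀ i, |a i - b i| ≤ M) :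
    |(⨅ i, a i) - ⨅ i, b i| ≤ M := by
  rw [abs_le]
  constructor
  · have : (⨅ i, b i) - M ≤ ⨅ i, a i := le_ciInf fun i => by
      have h1 := ciInf_le hb i
      have h2 := abs_le.1 (h i)
      linarith
    linarith
  · have : (⨅ i, a i) - M ≤ ⨅ i, b i := le_ciInf fun i => by
      have h1 := ciInf_le ha i
      have h2 := abs_le.1 (h i)
      linarith
    linarith

/-! ### The Bellman equation -/

section Bellman

variable {X U : Type*} [TopologicalSpace X] [MeasurableSpace X] [TopologicalSpace U] [MeasurableSpace U]
  {T : Kernel (X × U) X} [IsMarkovKernel T] {β : ℝ} {c : X × U → ℝ}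

/-- The one-step cost plus the discounted expected value of `v` at the next state. -/
noncomputable def qValue (β : ℝ) (c : X × U → ℝ) (T : Kernel (X × U) X) (v : X → ℝ)
    (p : X × U) : ℝ :=
  c p + β * ∫ y, v y ∂T p

omit [IsMarkovKernel T] in
lemma Regular.continuous_qValue (hT : Regular T c) (v : X →ᵇ ℝ) :
    Continuous (qValue β c T v) :=
  hT.continuous_cost.add (continuous_const.mul (hT.weakly_continuous v))

omit [IsMarkovKernel T] in
lemma Regular.abs_cost_le (hT : Regular T c) (p : X × U) : |c p| ≤ (supNorm c).toReal :=
  abs_le_toReal_supNorm hT.bounded p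

lemma Regular.abs_qValue_le (hT : Regular T c) (hβ0 : 0 ≤ β) (v : X →ᵇ ℝ) (p : X × U) :
    |qValue β c T v p| ≤ (supNorm c).toReal + β * ‖v‖ := by
  have h := abs_integral_le_of_abs_le (T := T) v.norm_coe_le_norm p
  refine (abs_add_le _ _).trans (add_le_add (hT.abs_cost_le p) ?_)
  rw [abs_mul, abs_of_nonneg hβ0]
  exact mul_le_mul_of_nonneg_left h hβ0

lemma Regular.bddBelow_qValue (hT : Regular T c) (hβ0 : 0 ≤ β) (v : X →ᵇ ℝ) (x : X) :
    BddBelow (Set.range fun u => qValue β c T v (x, u)) :=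
  ⟨_, Set.forall_mem_range.2 fun u => (abs_le.1 (hT.abs_qValue_le hβ0 v (x, u))).1⟩

variable [BorelSpace X]

omit [TopologicalSpace U] in
lemma abs_integral_sub_integral_le (v w : X →ᵇ ℝ) (p : X × U) :
    |∫ y, v y ∂T p - ∫ y, w y ∂T p| ≤ dist v w := by
  rw [← integral_sub (v.integrable _) (w.integrable _)]
  exact abs_integral_le_of_abs_le (fun y => v.dist_coe_le_dist (g := w) y) p

/-- The Bellman optimality equation has a bounded continuous solution. -/
lemma Regular.exists_bellman_solution [Nonempty U] (hT : Regular T c) (hβ0 : 0 ≤ β)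
    (hβ1 : β < 1) : ∃ v : X →ᵇ ℝ, ∀ x, v x = ⨅ u, qValue β c T v (x, u) := by
  have := hT.compact
  have hcont : ∀ v : X →ᵇ ℝ, Continuous fun x => ⨅ u, qValue β c T v (x, u) := fun v => by
    -- Compactness of `U` keeps the infimum over actions continuous in the state.
    have h := isCompact_univ.continuous_sInf (f := fun x u => qValue β c T v (x, u))
      (hT.continuous_qValue v)
    simp only [Set.image_univ] at h
    exact h
  let B : (X →ᵇ ℝ) → (X →ᵇ ℝ) := fun v => BoundedContinuousFunction.ofNormedAddCommGroup _
    (hcont v) ((supNorm c).toReal + β * ‖v‖) fun x => by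
      have h := fun u => hT.abs_qValue_le hβ0 v (x, u)
      obtain ⟨u⟩ := ‹Nonempty U›
      rw [Real.norm_eq_abs, abs_le]
      exact ⟨le_ciInf fun u => (abs_le.1 (h u)).1,
        (ciInf_le (hT.bddBelow_qValue hβ0 v x) u).trans (abs_le.1 (h u)).2⟩
  -- Infima and integration against probability measures are nonexpansive, so the factor `β`
  -- remains.
  have hB : ContractingWith ⟨β, hβ0⟩ B := by
    refine ⟨hβ1, LipschitzWith.of_dist_le_mul fun v w => ?_⟩
    refine (BoundedContinuousFunction.dist_le (by positivity)).2 fun x => ?_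
    refine abs_ciInf_sub_ciInf_le (hT.bddBelow_qValue hβ0 v x) (hT.bddBelow_qValue hβ0 w x)
      fun u => ?_
    rw [qValue, qValue, add_sub_add_left_eq_sub, ← mul_sub, abs_mul, abs_of_nonneg hβ0]
    exact mul_le_mul_of_nonneg_left (abs_integral_sub_integral_le v w _) hβ0
  exact ⟨hB.fixedPoint, fun x => (DFunLike.congr_fun hB.fixedPoint_isFixedPt x).symm⟩

omit [BorelSpace X] in
lemma Regular.residual_nonneg (hT : Regular T c) (hβ0 : 0 ≤ β) {v : X →ᵇ ℝ}
    (hv : ∀ x, v x = ⨅ u, qValue β c T v (x, u)) (p : X × U) : 0 ≤ residual β c T v p :=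
  sub_nonneg.2 <| (hv p.1).le.trans (ciInf_le (hT.bddBelow_qValue hβ0 v p.1) p.2)

variable [SecondCountableTopology U] [BorelSpace U]

omit [IsMarkovKernel T] in
lemma Regular.measurable_cost (hT : Regular T c) : Measurable c :=
  hT.continuous_cost.measurable

omit [IsMarkovKernel T] [BorelSpace U] in
-- By continuity in the action, a dense sequence of actions meets each strict sublevel set. Taking
-- the first index that works gives a measurable selection.
lemma Regular.exists_almost_minimizer [Nonempty U] (hT : Regular T c) {v : X →ᵇ ℝ}
    (hv : ∀ x, v x = ⨅ u, qValue β c T v (x, u)) {ε : ℝ} (hε : 0 < ε) :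
    ∃ f : X → U, Measurable f ∧ ∀ x, residual β c T v (x, f x) ≤ ε := by
  classical
  have hq := hT.continuous_qValue (β := β) v
  have hex : ∀ x, ∃ n, qValue β c T v (x, TopologicalSpace.denseSeq U n) < v x + ε := fun x => by
    obtain ⟨u, hu⟩ := exists_lt_of_ciInf_lt
      (show ⨅ u, qValue β c T v (x, u) < v x + ε by rw [← hv x]; linarith)
    obtain ⟨n, hu'⟩ := (TopologicalSpace.denseRange_denseSeq U).exists_mem_open
      (isOpen_lt (hq.comp (Continuous.prodMk_right x)) continuous_const) ⟨u, hu⟩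
    exact ⟨n, hu'⟩
  refine ⟨fun x => TopologicalSpace.denseSeq U (Nat.find (hex x)),
    measurable_from_nat.comp (measurable_find hex fun n => measurableSet_lt
      (hq.comp (Continuous.prodMk_left _)).measurable
      (v.continuous.measurable.add_const ε)), fun x => ?_⟩
  have h := Nat.find_spec (hex x)
  have h' : residual β c T v (x, TopologicalSpace.denseSeq U (Nat.find (hex x))) =
    qValue β c T v (x, TopologicalSpace.denseSeq U (Nat.find (hex x))) - v x := rfl
  linarith

/-- The optimal value function is a bounded continuous solution of the Bellman equation. -/
lemma Regular.exists_optimalValue_eq [T2Space U] [Nonempty U] (hT : Regular T c) (hβ0 : 0 ≤ β)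
    (hβ1 : β < 1) :
    ∃ v : X →ᵇ ℝ, optimalValue β c T = v ∧ ∀ x, v x = ⨅ u, qValue β c T v (x, u) := by
  obtain ⟨v, hv⟩ := hT.exists_bellman_solution hβ0 hβ1
  refine ⟨v, funext fun x => le_antisymm ?_ ?_, hv⟩
  all_goals
    have hle := fun γ : Policy X U => le_value_of_residual_nonneg T γ x hβ0 hβ1 hT.measurable_cost
      hT.abs_cost_le v.continuous.measurable v.norm_coe_le_norm (hT.residual_nonneg hβ0 hv)
  · refine le_of_forall_pos_le_add fun ε hε => ?_
    -- The tolerance `ε * (1 - β)` at each step accumulates to `ε` over the geometric series.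
    obtain ⟨f, hf, hfε⟩ := hT.exists_almost_minimizer hv
      (show 0 < ε * (1 - β) from mul_pos hε (sub_pos.2 hβ1))
    have h := abs_value_stationary_sub_le (x := x) hf hβ0 hβ1 hT.measurable_cost hT.abs_cost_le
      v.continuous.measurable v.norm_coe_le_norm (M := ε * (1 - β)) fun y => by
        rw [abs_of_nonneg (hT.residual_nonneg hβ0 hv _)]
        exact hfε y
    rw [mul_div_cancel_right₀ _ (sub_pos.2 hβ1).ne'] at h
    have h1 : optimalValue β c T x ≤ value β c T (stationary f hf) x :=
      ciInf_le ⟨v x, Set.forall_mem_range.2 hle⟩ _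
    linarith [(abs_le.1 h).2]
  · have : Nonempty (Policy X U) :=
      ⟨stationary (fun _ => Classical.arbitrary U) measurable_const⟩
    exact le_ciInf hle

end Bellman

/-! ### Comparison of two models -/

section Robustness

variable {X U : Type*} [TopologicalSpace X] [MeasurableSpace X] [MeasurableSpace U]
  {T S : Kernel (X × U) X} [IsMarkovKernel T] [IsMarkovKernel S] {β : ℝ} {c c' : X × U → ℝ}

lemma discrepancy_ne_top (v : X →ᵇ ℝ) : discrepancy v T S ≠ ∞ :=
  ((supNorm_le_ofReal (M := ‖v‖ + ‖v‖) fun q => (abs_sub _ _).trans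
    (add_le_add (abs_integral_le_of_abs_le v.norm_coe_le_norm q)
      (abs_integral_le_of_abs_le v.norm_coe_le_norm q))).trans_lt ENNReal.ofReal_lt_top).ne

lemma abs_integral_sub_integral_le_discrepancy (v : X →ᵇ ℝ) (p : X × U) :
    |∫ y, v y ∂T p - ∫ y, v y ∂S p| ≤ (discrepancy v T S).toReal :=
  abs_le_toReal_supNorm (g := fun p => ∫ y, v y ∂T p - ∫ y, v y ∂S p)
    (discrepancy_ne_top v).lt_top p

omit [TopologicalSpace X] [IsMarkovKernel T] [IsMarkovKernel S] in
lemma discrepancy_comm (v : X → ℝ) : discrepancy v T S = discrepancy v S T := by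
  simp only [discrepancy, ← edist_eq_enorm_sub, edist_comm]

variable [BorelSpace X]

/-- Inserting `∫ v dS` puts the whole kernel error on `v`; the other error is independent of the
kernels. -/
lemma abs_qValue_sub_qValue_le (hβ0 : 0 ≤ β) {δ : ℝ} (hδ : ∀ p, |c p - c' p| ≤ δ)
    (v w : X →ᵇ ℝ) (p : X × U) : |qValue β c T v p - qValue β c' S w p| ≤
      δ + β * ((discrepancy v T S).toReal + dist v w) := by
  have h2 : |∫ y, v y ∂T p - ∫ y, w y ∂S p| ≤ (discrepancy v T S).toReal + dist v w :=
    (abs_sub_le _ (∫ y, v y ∂S p) _).trans (add_le_add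
      (abs_integral_sub_integral_le_discrepancy v p) (abs_integral_sub_integral_le v w p))
  have h3 : qValue β c T v p - qValue β c' S w p =
      (c p - c' p) + β * (∫ y, v y ∂T p - ∫ y, w y ∂S p) := by
    unfold qValue
    ring
  rw [h3]
  refine (abs_add_le _ _).trans (add_le_add (hδ p) ?_)
  rw [abs_mul, abs_of_nonneg hβ0]
  exact mul_le_mul_of_nonneg_left h2 hβ0

variable [TopologicalSpace U]

/-- Continuity of the optimal value function in the cost and the transition kernel. -/
lemma dist_bellman_solution_le [Nonempty U] (hT : Regular T c) (hS : Regular S c')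
    (hβ0 : 0 ≤ β) (hβ1 : β < 1) {δ : ℝ} (hδ0 : 0 ≤ δ) (hδ : ∀ p, |c p - c' p| ≤ δ)
    {v w : X →ᵇ ℝ} (hv : ∀ x, v x = ⨅ u, qValue β c T v (x, u))
    (hw : ∀ x, w x = ⨅ u, qValue β c' S w (x, u)) :
    dist v w ≤ (δ + β * (discrepancy v T S).toReal) / (1 - β) := by
  -- The distance bounds itself with factor `β < 1`; solving for it produces `1 / (1 - β)`.
  have h : dist v w ≤ δ + β * ((discrepancy v T S).toReal + dist v w) := by
    refine (BoundedContinuousFunction.dist_le (by positivity)).2 fun x => ?_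
    rw [Real.dist_eq, hv x, hw x]
    exact abs_ciInf_sub_ciInf_le (hT.bddBelow_qValue hβ0 v x) (hS.bddBelow_qValue hβ0 w x)
      fun u => abs_qValue_sub_qValue_le hβ0 hδ v w (x, u)
  rw [le_div_iff₀ (sub_pos.2 hβ1)]
  linarith

variable [SecondCountableTopology U] [BorelSpace U] [T2Space U]

/-- Real-valued robustness estimates for the policy `f` that is optimal for `(S, c')`, evaluated
in the model `(T, c)`. The bounds are on the distances to the two optimal value functions. -/
lemma abs_value_stationary_sub_optimalValue_le (hT : Regular T c) (hS : Regular S c')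
    (hβ0 : 0 ≤ β) (hβ1 : β < 1) {δ : ℝ} (hδ : ∀ p, |c p - c' p| ≤ δ)
    {f : X → U} (hf : Measurable f) (hopt : IsOptimal β c' S f hf) {v w : X →ᵇ ℝ}
    (hw' : optimalValue β c' S = w)
    (hw : ∀ x, w x = ⨅ u, qValue β c' S w (x, u)) (x : X) :
    |value β c T (stationary f hf) x - w x| ≤
        (δ + β * (discrepancy w T S).toReal) / (1 - β) ∧
      |value β c T (stationary f hf) x - v x| ≤
        (δ + β * ((discrepancy v T S).toReal + dist v w) + dist v w) / (1 - β) := by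
  have hfw : ∀ y, qValue β c' S w (y, f y) = w y := fun y =>
    sub_eq_zero.1 <| residual_eq_zero_of_value_eq hf hβ0 hβ1 hS.measurable_cost hS.abs_cost_le
      w.continuous.measurable w.norm_coe_le_norm (hS.residual_nonneg hβ0 hw)
      ((hopt y).trans (congrFun hw' y))
  constructor
  · refine abs_value_stationary_sub_le hf hβ0 hβ1 hT.measurable_cost hT.abs_cost_le
      w.continuous.measurable w.norm_coe_le_norm fun y => ?_
    have h := abs_qValue_sub_qValue_le (T := T) (S := S) hβ0 hδ w w (y, f y)
    rw [hfw, dist_self, add_zero] at h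
    exact h
  · refine abs_value_stationary_sub_le hf hβ0 hβ1 hT.measurable_cost hT.abs_cost_le
      v.continuous.measurable v.norm_coe_le_norm fun y => ?_
    have h := abs_qValue_sub_qValue_le (T := T) (S := S) hβ0 hδ v w (y, f y)
    rw [hfw] at h
    -- The second `dist v w` comes from replacing `w y` by `v y` in the subtracted term.
    refine (abs_sub_le _ (w y) _).trans (add_le_add h ?_)
    rw [dist_comm]
    exact w.dist_coe_le_dist y

end Robustness

end MDP

/-! ### The three robustness bounds -/

theorem mainTheorem2 {X U : Type*}
    [TopologicalSpace X] [PolishSpace X] [MeasurableSpace X] [BorelSpace X]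
    [TopologicalSpace U] [PolishSpace U] [MeasurableSpace U] [BorelSpace U]
    (T S : Kernel (X × U) X) [IsMarkovKernel T] [IsMarkovKernel S]
    (c c' : X × U → ℝ) (hT : MDP.Regular T c) (hS : MDP.Regular S c')
    (β : ℝ) (hβ0 : 0 < β) (hβ1 : β < 1)
    (f : X → U) (hf : Measurable f) (hopt : MDP.IsOptimal β c' S f hf) :
    MDP.supNorm (fun x => MDP.value β c T (MDP.stationary f hf) x - MDP.optimalValue β c T x) ≤
        ENNReal.ofReal (2 / (1 - β) ^ 2) * MDP.supNorm (fun p => c p - c' p) +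
          ENNReal.ofReal (2 * β / (1 - β) ^ 2) *
            MDP.discrepancy (MDP.optimalValue β c T) T S ∧
      MDP.supNorm (fun x => MDP.value β c T (MDP.stationary f hf) x - MDP.optimalValue β c T x) ≤
        ENNReal.ofReal (2 / (1 - β)) * MDP.supNorm (fun p => c p - c' p) +
          ENNReal.ofReal (β / (1 - β)) *
            (MDP.discrepancy (MDP.optimalValue β c T) T S +
              MDP.discrepancy (MDP.optimalValue β c' S) T S) ∧
      MDP.supNorm (fun x => MDP.value β c T (MDP.stationary f hf) x - MDP.optimalValue β c T x) ≤
        ENNReal.ofReal (2 / (1 - β)) * MDP.supNorm (fun p => c p - c' p) +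
          ENNReal.ofReal (2 * β / (1 - β)) *
            MDP.discrepancy (MDP.optimalValue β c' S) T S := by
  cases isEmpty_or_nonempty X with
  | inl hX => simp [MDP.supNorm]
  | inr hX =>
  have hU : Nonempty U := hX.map f
  obtain ⟨v, hv', hv⟩ := hT.exists_optimalValue_eq hβ0.le hβ1
  obtain ⟨w, hw', hw⟩ := hS.exists_optimalValue_eq hβ0.le hβ1
  have h1β : 0 < 1 - β := sub_pos.2 hβ1
  have hδtop : MDP.supNorm (fun p => c p - c' p) < ∞ :=
    (MDP.supNorm_le_ofReal fun p => (abs_sub _ _).trans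
      (add_le_add (hT.abs_cost_le p) (hS.abs_cost_le p))).trans_lt ENNReal.ofReal_lt_top
  have hδ := fun p => MDP.abs_le_toReal_supNorm hδtop p
  have hest := MDP.abs_value_stationary_sub_optimalValue_le (v := v) hT hS hβ0.le hβ1 hδ hf hopt
    hw' hw
  have hdv := MDP.dist_bellman_solution_le hT hS hβ0.le hβ1 ENNReal.toReal_nonneg hδ hv hw
  -- With the two models exchanged, the same estimate involves the discrepancy of `w`.
  have hdw := MDP.dist_bellman_solution_le hS hT hβ0.le hβ1 ENNReal.toReal_nonneg
    (fun p => (abs_sub_comm _ _).trans_le (hδ p)) hw hv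
  have hvw := fun x => w.dist_coe_le_dist (g := v) x
  rw [MDP.discrepancy_comm, dist_comm] at hdw
  rw [hv', hw', ← ENNReal.ofReal_toReal hδtop.ne,
    ← ENNReal.ofReal_toReal (MDP.discrepancy_ne_top (T := T) (S := S) v),
    ← ENNReal.ofReal_toReal (MDP.discrepancy_ne_top (T := T) (S := S) w)]
  have hδ0 : 0 ≤ (MDP.supNorm fun p => c p - c' p).toReal := ENNReal.toReal_nonneg
  have hDv0 : 0 ≤ (MDP.discrepancy v T S).toReal := ENNReal.toReal_nonneg
  have hDw0 : 0 ≤ (MDP.discrepancy w T S).toReal := ENNReal.toReal_nonneg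
  generalize (MDP.supNorm fun p => c p - c' p).toReal = δ at *
  generalize (MDP.discrepancy v T S).toReal = Dv at *
  generalize (MDP.discrepancy w T S).toReal = Dw at *
  rw [← ENNReal.ofReal_add hDv0 hDw0]
  simp only [← ENNReal.ofReal_mul' hδ0, ← ENNReal.ofReal_mul' hDv0, ← ENNReal.ofReal_mul' hDw0,
    ← ENNReal.ofReal_mul' (add_nonneg hDv0 hDw0)]
  rw [← ENNReal.ofReal_add (by positivity) (by positivity),
    ← ENNReal.ofReal_add (by positivity) (by positivity),
    ← ENNReal.ofReal_add (by positivity) (by positivity)]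
  have htri : ∀ x, |MDP.value β c T (MDP.stationary f hf) x - v x| ≤
      (δ + β * Dw) / (1 - β) + dist v w := fun x =>
    (abs_sub_le _ (w x) _).trans (add_le_add (hest x).1 ((hvw x).trans_eq (dist_comm _ _)))
  refine ⟨MDP.supNorm_le_ofReal fun x => ?_, MDP.supNorm_le_ofReal fun x => ?_,
    MDP.supNorm_le_ofReal fun x => ?_⟩
  · refine (hest x).2.trans ?_
    rw [div_le_iff₀ h1β]
    -- The constant 2 arises from `1 + (1 + β) / (1 - β) = 2 / (1 - β)`.
    have h := mul_le_mul_of_nonneg_left hdv (show 0 ≤ 1 + β by linarith)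
    calc δ + β * (Dv + dist v w) + dist v w = δ + β * Dv + (1 + β) * dist v w := by ring
      _ ≤ δ + β * Dv + (1 + β) * ((δ + β * Dv) / (1 - β)) := by linarith
      _ = _ := by
        field_simp
        ring
  · refine (htri x).trans ((add_le_add_right hdv _).trans_eq ?_)
    field_simp
    ring
  · refine (htri x).trans ((add_le_add_right hdw _).trans_eq ?_)
    field_simp
    ring
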